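/- Let $\sigma,\tau\in\mathbb{C}$ with $\sigma\neq 0$, $\operatorname{Im}\tau>0$, put $p=e^{2\pi i\tau}$, $q^{x}=e^{2\pi i\sigma x}$ for $x\in\mathbb{C}$ (so $q=e^{2\pi i\sigma}$), and $$\theta(z;p)=\prod_{n\ge 0}(1-zp^{n})(1-z^{-1}p^{n+1}),\qquad \theta(t;p;q)_n=\prod_{m=0}^{n-1}\theta(tq^m;p),\qquad \theta(t;p;q)_{-n}=\frac{1}{\theta(tq^{-n};p;q)_n}\quad(n\ge 0).$$ The theta hypergeometric series ${}_{r+1}E_r$ and ${}_{r}G_{r}$ with parameters $t_m=q^{u_m}$, $w_k=q^{v_k}$ and argument $z$ are the formal series $$\sum_{n\ge 0}\frac{\prod_{m=0}^{r}\theta(t_m;p;q)_n}{\theta(q;p;q)_n\prod_{k=1}^{r}\theta(w_k;p;q)_n}\,z^n,\qquad \sum_{n\in\mathbb{Z}}\prod_{m=1}^{r}\frac{\theta(t_m;p;q)_n}{\theta(w_m;p;q)_n}\,z^n ;$$ they are called balanced if $u_0+\dots+u_r=1+v_1+\dots+v_r$, respectively $u_1+\dots+u_r=v_1+\dots+v_r$.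 Let $h$ be an elliptic function with $h(x+\sigma^{-1})=h(x+\tau\sigma^{-1})=h(x)$, and let $r+1$ be its order, i.e. the number of its poles, counted with multiplicity, in the parallelogram of periods spanned by $\sigma^{-1}$ and $\tau\sigma^{-1}$. (1) Unilateral series. Let the argument of $h$ be shifted so that $h$ has a pole at $-1$; that is, let $P$ be any pole of $h$ and put $\tilde h(x)=h(P+1+x)$. Then there are $u_0,\dots,u_r,v_1,\dots,v_r\in\mathbb{C}$ and $z\ne 0$ satisfying the balancing condition $u_0+\dots+u_r=1+v_1+\dots+v_r$ such that $$\tilde h(x)=z\,\frac{\prod_{m=0}^r\theta(t_mq^x;p)}{\theta(q^{x+1};p)\prod_{k=1}^r\theta(w_kq^x;p)}$$ as meromorphic functions, and every series $\sum_{n\ge 0}c_n$ with $c_{n+1}/c_n=\tilde h(n)$ for $n\ge 0$ (where $\tilde h$ has no pole at any $n\ge 0$) is, term by term, $c_0$ times the balanced ${}_{r+1}E_r$ series with these parameters, none of whose terms has a zero denominator. (2) Bilateral series. There are $u_0,\dots,u_r,v_0,\dots,v_r\in\mathbb{C}$ and $z\neq 0$ satisfying the balancing condition $u_0+\dots+u_r=v_0+\dots+v_r$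 such that $$h(x)=z\prod_{m=0}^r\frac{\theta(t_mq^x;p)}{\theta(w_mq^x;p)}$$ as meromorphic functions, and every series $\sum_{n\in\mathbb{Z}}c_n$ with $c_{n+1}/c_n=h(n)$, meaning $c_{n+1}=h(n)c_n$ for $n\ge 0$ (where $h$ has no pole at any integer $n\geq 0$) and $c_n=h(n)^{-1}c_{n+1}$ for $n<0$ (where $h$ has no zero at any integer $n<0$), is, term by term, $c_0$ times the balanced ${}_{r+1}G_{r+1}$ series with these parameters, none of whose terms has a zero denominator. -/

import Mathlib

open Filter Topology

noncomputable section

namespace EllipticHypergeometric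

/-- The power `q ^ x = exp (2 π i σ x)` with complex exponent `x`, where `q = exp (2 π i σ)`. -/
def qPow (σ x : ℂ) : ℂ := Complex.exp (2 * Real.pi * Complex.I * σ * x)

/-- The elliptic nome `p = exp (2 π i τ)`. -/
def nome (τ : ℂ) : ℂ := Complex.exp (2 * Real.pi * Complex.I * τ)

/-- The infinite product `(a; p)_∞ = ∏_{n ≥ 0} (1 - a p ^ n)` (used for `‖p‖ < 1`). -/
def pochhammerInf (a p : ℂ) : ℂ := ∏' n : ℕ, (1 - a * p ^ n)

/-- The theta function `θ(z; p) = (z; p)_∞ (p z⁻¹; p)_∞` (used for `z ≠ 0`, `‖p‖ < 1`). -/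
def theta (z p : ℂ) : ℂ := pochhammerInf z p * pochhammerInf (p * z⁻¹) p

/-- The elliptic shifted factorial `θ(t; p; q)_n = ∏_{m < n} θ(t q ^ m; p)` for `n ≥ 0`. -/
def thetaPochhammerNat (t p q : ℂ) (n : ℕ) : ℂ := ∏ m ∈ Finset.range n, theta (t * q ^ m) p

/-- The elliptic shifted factorial for all integers, where
`θ(t; p; q)_{-n} = 1 / θ(t q ^ (-n); p; q)_n` for `n > 0`. -/
def thetaPochhammer (t p q : ℂ) : ℤ → ℂ
  | Int.ofNat n => thetaPochhammerNat t p q n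
  | Int.negSucc n => 1 / thetaPochhammerNat (t * q ^ (Int.negSucc n)) p q (n + 1)

/-- The `n`-th term of the unilateral theta hypergeometric series `_rE_s` with numerator parameters
`t`, denominator parameters `q, w_1, …, w_s`, and `q = exp (2 π i σ)`, `p = exp (2 π i τ)`. -/
def termE {r s : ℕ} (σ τ : ℂ) (t : Fin r → ℂ) (w : Fin s → ℂ) (α z : ℂ) (n : ℕ) : ℂ :=
  (∏ m, thetaPochhammerNat (t m) (nome τ) (qPow σ 1) n) /
    (thetaPochhammerNat (qPow σ 1) (nome τ) (qPow σ 1) n *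
      ∏ k, thetaPochhammerNat (w k) (nome τ) (qPow σ 1) n) *
    qPow σ (α * n * (n - 1) / 2) * z ^ n

/-- The `n`-th term of the bilateral theta hypergeometric series `_rG_s`. For negative `n` it
vanishes where the reciprocal `1 / θ(w_k; p; q)_n` is zero, that is, where
`θ(w_k q ^ n; p; q)_{-n} = 0`; division by zero being zero, the formula gives this value. -/
def termG {r s : ℕ} (σ τ : ℂ) (t : Fin r → ℂ) (w : Fin s → ℂ) (α z : ℂ) (n : ℤ) : ℂ :=
  (∏ m, thetaPochhammer (t m) (nome τ) (qPow σ 1) n) /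
    (∏ k, thetaPochhammer (w k) (nome τ) (qPow σ 1) n) *
    qPow σ (α * n * (n - 1) / 2) * z ^ n

/-- The ratio `c_{n+1} / c_n` of consecutive terms of `_rE_s`, as a function of a complex
variable `x` in place of `n`. -/
def ratioE {r s : ℕ} (σ τ : ℂ) (t : Fin r → ℂ) (w : Fin s → ℂ) (α z x : ℂ) : ℂ :=
  (∏ m, theta (t m * qPow σ x) (nome τ)) /
    (theta (qPow σ 1 * qPow σ x) (nome τ) * ∏ k, theta (w k * qPow σ x) (nome τ)) *
    qPow σ (α * x) * z

/-- The ratio `c_{n+1} / c_n` of consecutive terms of `_rG_s`, as a function of a complex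
variable `x` in place of `n`. -/
def ratioG {r s : ℕ} (σ τ : ℂ) (t : Fin r → ℂ) (w : Fin s → ℂ) (α z x : ℂ) : ℂ :=
  (∏ m, theta (t m * qPow σ x) (nome τ)) / (∏ k, theta (w k * qPow σ x) (nome τ)) *
    qPow σ (α * x) * z

/-- The parameters `t_m = q ^ u_m`, `w_k = q ^ v_k` of an `_{r+1}E_r` series are balanced. -/
def BalancedE {r : ℕ} (u : Fin (r + 1) → ℂ) (v : Fin r → ℂ) : Prop :=
  ∑ m, u m = 1 + ∑ k, v k

/-- The parameters `t_m = q ^ u_m`, `w_k = q ^ v_k` of an `_rG_r` series are balanced. -/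
def BalancedG {r : ℕ} (u v : Fin r → ℂ) : Prop :=
  ∑ m, u m = ∑ k, v k

/-- No term of the `_rE_s` series has a zero denominator. -/
def NonsingularE {s : ℕ} (σ τ : ℂ) (w : Fin s → ℂ) : Prop :=
  ∀ n : ℕ, theta (qPow σ 1 * qPow σ n) (nome τ) ≠ 0 ∧
    ∀ k, theta (w k * qPow σ n) (nome τ) ≠ 0

/-- No term of the `_rG_s` series has a zero denominator: the denominators of the terms of
non-negative index come from `w`, those of negative index from `t`. -/
def NonsingularG {r s : ℕ} (σ τ : ℂ) (t : Fin r → ℂ) (w : Fin s → ℂ) : Prop :=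
  (∀ n : ℤ, 0 ≤ n → ∀ k, theta (w k * qPow σ n) (nome τ) ≠ 0) ∧
    (∀ n : ℤ, n < 0 → ∀ m, theta (t m * qPow σ n) (nome τ) ≠ 0)

/-- `h` is an elliptic function with periods `σ⁻¹` and `τ σ⁻¹`. -/
structure IsElliptic (σ τ : ℂ) (h : ℂ → ℂ) : Prop where
  meromorphic : Meromorphic h
  periodic_one : ∀ x, h (x + σ⁻¹) = h x
  periodic_tau : ∀ x, h (x + τ * σ⁻¹) = h x

/-- The half-open parallelogram of periods spanned by `σ⁻¹` and `τ σ⁻¹`. -/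
def periodParallelogram (σ τ : ℂ) : Set ℂ :=
  {x | ∃ a b : ℝ, a ∈ Set.Ico (0 : ℝ) 1 ∧ b ∈ Set.Ico (0 : ℝ) 1 ∧ x = a * σ⁻¹ + b * (τ * σ⁻¹)}

/-- The multiplicity of `x` as a pole of `h` (zero if `x` is not a pole). -/
def poleMultiplicity (h : ℂ → ℂ) (x : ℂ) : ℕ := (-(meromorphicOrderAt h x).untop₀).toNat

/-- The order of an elliptic function: the number of its poles in the parallelogram of periods,
counted with multiplicity. -/
def ellipticOrder (σ τ : ℂ) (h : ℂ → ℂ) : ℕ :=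
  ∑ᶠ x ∈ periodParallelogram σ τ, poleMultiplicity h x

/-- `c_{n+1} / c_n = h(n)` for all `n ∈ ℕ`: the meromorphic function `h` has the finite value `a`
at `n` and `c_{n+1} = a c_n`. The value is the limit at `n`, so that the value that the Lean
function takes at the point itself does not matter. -/
def IsUnilateralSeries (h : ℂ → ℂ) (c : ℕ → ℂ) : Prop :=
  ∀ n : ℕ, ∃ a : ℂ, Tendsto h (𝓝[≠] (n : ℂ)) (𝓝 a) ∧ c (n + 1) = a * c n

/-- `c_{n+1} / c_n = h(n)` for all `n ∈ ℤ`, solved from `c_0` in both directions: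
`c_{n+1} = h(n) c_n` for `n ≥ 0`, with `h` finite at `n`, and `c_n = (1 / h)(n) c_{n+1}` for
`n < 0`, with `1 / h` finite at `n`. Zeros of `h` at integers `n ≥ 0` and poles of `h` at integers
`n < 0` are allowed; they terminate the series. -/
def IsBilateralSeries (h : ℂ → ℂ) (c : ℤ → ℂ) : Prop :=
  (∀ n : ℤ, 0 ≤ n → ∃ a : ℂ, Tendsto h (𝓝[≠] (n : ℂ)) (𝓝 a) ∧ c (n + 1) = a * c n) ∧
    (∀ n : ℤ, n < 0 → ∃ a : ℂ,
      Tendsto (fun x => (h x)⁻¹) (𝓝[≠] (n : ℂ)) (𝓝 a) ∧ c n = a * c (n + 1))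

end EllipticHypergeometric

end

noncomputable section

namespace EllipticHypergeometric

variable {σ τ : ℂ}

/-! ### Powers of `q` -/

/-! In the additive variable, θ(q^x; p) is entire with simple zeros exactly on the lattice of
periods. It has period σ⁻¹ and gains the factor -q^(-x) under x ↦ x + τσ⁻¹. Hence the product K of
θ(q^(x-a); p)^(n a), over the zeros and poles a of h in one parallelogram, with n a the order of h
at a, has the divisor of h.

After removal of singularities, f = h / K is entire, nowhere zero and quasi-periodic. Its
logarithmic derivative g changes by a constant under each period, so g' is constant by Liouville's
theorem. Period σ⁻¹ then makes g constant, and the τσ⁻¹ law forces ∑ n a = 0, so h has as many zeros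
as poles, without contour integration. Moreover f = C q^(kx), and the multiplier under τσ⁻¹ puts ∑ n
a · a in the lattice, with the same k as its coefficient (`IsElliptic.exists_eq_mul_thetaProduct`).
Translating a single zero by that lattice element therefore both absorbs q^(kx) and makes the
balancing condition exact (`IsElliptic.exists_eq_theta_quotient`). This is the bilateral ratio.

For the unilateral ratio, a pole at P identifies one denominator factor, after translation by P + 1,
with θ(q^(x+1); p) up to a period; that period is moved to a numerator parameter
(`exists_ratioE_of_pole`). Numerator and denominator share no zeros, so finiteness of h at n means
that the denominator is nonzero there, and the terms follow by induction. -/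

theorem qPow_add (σ x y : ℂ) : qPow σ (x + y) = qPow σ x * qPow σ y := by
  simp only [qPow, mul_add, Complex.exp_add]

@[simp] theorem qPow_zero (σ : ℂ) : qPow σ 0 = 1 := by simp [qPow]

theorem qPow_ne_zero (σ x : ℂ) : qPow σ x ≠ 0 := Complex.exp_ne_zero _

theorem qPow_neg (σ x : ℂ) : qPow σ (-x) = (qPow σ x)⁻¹ := by
  simp [qPow, ← Complex.exp_neg]

theorem qPow_int_mul (σ x : ℂ) (n : ℤ) : qPow σ (n * x) = qPow σ x ^ n := by
  rw [qPow, qPow, ← Complex.exp_int_mul]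
  ring_nf

theorem qPow_sum {ι : Type*} (σ : ℂ) (s : Finset ι) (f : ι → ℂ) :
    qPow σ (∑ i ∈ s, f i) = ∏ i ∈ s, qPow σ (f i) := by
  simp only [qPow, Finset.mul_sum, Complex.exp_sum]

theorem differentiable_qPow (σ : ℂ) : Differentiable ℂ (qPow σ) := by
  unfold qPow
  fun_prop

theorem qPow_mul_inv (σ τ : ℂ) (hσ : σ ≠ 0) : qPow σ (τ * σ⁻¹) = nome τ := by
  rw [qPow, nome]
  congr 1
  field_simp

theorem qPow_eq_one_iff {σ x : ℂ} (hσ : σ ≠ 0) : qPow σ x = 1 ↔ ∃ n : ℤ, x = n * σ⁻¹ := by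
  rw [qPow, Complex.exp_eq_one_iff]
  refine exists_congr fun n => ?_
  have h := Complex.two_pi_I_ne_zero
  rw [show 2 * Real.pi * Complex.I * σ * x = (σ * x) * (2 * Real.pi * Complex.I) by ring,
    mul_left_inj' h, eq_mul_inv_iff_mul_eq₀ hσ, mul_comm]

theorem qPow_inv {σ : ℂ} (hσ : σ ≠ 0) : qPow σ σ⁻¹ = 1 :=
  (qPow_eq_one_iff hσ).2 ⟨1, by simp⟩

theorem nome_ne_zero (τ : ℂ) : nome τ ≠ 0 := Complex.exp_ne_zero _

theorem norm_nome_lt_one {τ : ℂ} (hτ : 0 < τ.im) : ‖nome τ‖ < 1 := by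
  rw [nome, Complex.norm_exp, Real.exp_lt_one_iff]
  have := mul_pos Real.two_pi_pos hτ
  simp
  linarith

/-! ### The infinite products -/

theorem summable_norm_neg_mul_pow {p : ℂ} (hp : ‖p‖ < 1) (a : ℂ) :
    Summable fun n : ℕ => ‖-(a * p ^ n)‖ := by
  simpa using (summable_geometric_of_lt_one (norm_nonneg p) hp).mul_left ‖a‖

theorem multipliable_one_sub_mul_pow {p : ℂ} (hp : ‖p‖ < 1) (a : ℂ) :
    Multipliable fun n : ℕ => 1 - a * p ^ n := by
  simpa only [sub_eq_add_neg] using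
    multipliable_one_add_of_summable (summable_norm_neg_mul_pow hp a)

theorem pochhammerInf_eq_mul {p : ℂ} (hp : ‖p‖ < 1) (a : ℂ) :
    pochhammerInf a p = (1 - a) * pochhammerInf (p * a) p := by
  have h : (fun n : ℕ => 1 - a * p ^ (n + 1)) = fun n : ℕ => 1 - p * a * p ^ n :=
    funext fun n => by ring
  have hm : Multipliable fun n : ℕ => 1 - a * p ^ (n + 1) := by
    rw [h]
    exact multipliable_one_sub_mul_pow hp (p * a)
  have := tprod_eq_zero_mul' (f := fun n : ℕ => 1 - a * p ^ n) hm
  rw [h, pow_zero, mul_one] at this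
  exact this

theorem pochhammerInf_ne_zero {p : ℂ} (hp : ‖p‖ < 1) {a : ℂ} (h : ∀ n : ℕ, a * p ^ n ≠ 1) :
    pochhammerInf a p ≠ 0 := by
  rw [pochhammerInf]
  simp only [sub_eq_add_neg]
  refine tprod_one_add_ne_zero_of_summable (fun n => ?_) (summable_norm_neg_mul_pow hp a)
  rw [← sub_eq_add_neg, sub_ne_zero]
  exact (h n).symm

theorem differentiable_pochhammerInf {p : ℂ} (hp : ‖p‖ < 1) :
    Differentiable ℂ fun a => pochhammerInf a p := by
  intro a
  -- The geometric bound on the factors is uniform only for bounded arguments, hence a ball around 0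
  -- containing a.
  have hK : IsOpen (Metric.ball (0 : ℂ) (‖a‖ + 1)) := Metric.isOpen_ball
  have hu := (summable_geometric_of_lt_one (norm_nonneg p) hp).mul_left (‖a‖ + 1)
  have hprod := hu.hasProdLocallyUniformlyOn_nat_one_add (f := fun (n : ℕ) (a : ℂ) => -(a * p ^ n))
    hK (.of_forall fun n x hx => by
      rw [norm_neg, norm_mul, norm_pow]
      rw [mem_ball_zero_iff] at hx
      gcongr) (fun n => by fun_prop)
  have hd := hprod.differentiableOn (.of_forall fun _ => by
    simpa [Finset.prod_fn] using DifferentiableOn.finsetProd (fun _ _ => by fun_prop)) hK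
  have := hd.differentiableAt (hK.mem_nhds (mem_ball_zero_iff.2 (lt_add_one ‖a‖)))
  simpa only [pochhammerInf, sub_eq_add_neg] using this

/-! ### The theta function in the additive variable -/

/-- The theta function `θ(q ^ x; p)` as a function of `x`. -/
def addTheta (σ τ x : ℂ) : ℂ := theta (qPow σ x) (nome τ)

theorem theta_mul_qPow (σ τ u x : ℂ) :
    theta (qPow σ u * qPow σ x) (nome τ) = addTheta σ τ (x + u) := by
  rw [addTheta, add_comm, qPow_add]

/-- The lattice of periods. -/
def periodLattice (σ τ : ℂ) : AddSubgroup ℂ := AddSubgroup.closure {σ⁻¹, τ * σ⁻¹}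

theorem mem_periodLattice {σ τ x : ℂ} :
    x ∈ periodLattice σ τ ↔ ∃ l j : ℤ, x = l * σ⁻¹ + j * (τ * σ⁻¹) := by
  simp only [periodLattice, AddSubgroup.mem_closure_pair, zsmul_eq_mul, eq_comm]

variable {σ τ : ℂ}

theorem differentiable_addTheta (hτ : 0 < τ.im) : Differentiable ℂ (addTheta σ τ) := by
  have h := differentiable_pochhammerInf (norm_nome_lt_one hτ)
  have hq := differentiable_qPow σ
  have hq' : Differentiable ℂ fun x => nome τ * (qPow σ x)⁻¹ :=
    (hq.inv fun x => qPow_ne_zero σ x).const_mul _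
  exact (h.comp hq).mul (h.comp hq')

theorem addTheta_add_inv (hσ : σ ≠ 0) (x : ℂ) : addTheta σ τ (x + σ⁻¹) = addTheta σ τ x := by
  rw [addTheta, qPow_add, qPow_inv hσ, mul_one, addTheta]

/-- Replacing z = q^x by pz drops the factor 1 - z from one product and adds 1 - z⁻¹ to the other;
(1 - z⁻¹) = -z⁻¹(1 - z). -/
theorem addTheta_add_tau (hσ : σ ≠ 0) (hτ : 0 < τ.im) (x : ℂ) :
    addTheta σ τ (x + τ * σ⁻¹) = -qPow σ (-x) * addTheta σ τ x := by
  have hp := norm_nome_lt_one hτ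
  have hx := qPow_ne_zero σ x
  have hp0 := nome_ne_zero τ
  have h1 : nome τ * (qPow σ x * nome τ)⁻¹ = (qPow σ x)⁻¹ := by field_simp
  rw [addTheta, addTheta, theta, theta, qPow_add, qPow_mul_inv σ τ hσ, h1, qPow_neg,
    pochhammerInf_eq_mul hp (qPow σ x)⁻¹, pochhammerInf_eq_mul hp (qPow σ x), mul_comm (nome τ)]
  field_simp
  ring

/-- Under translation by a period, `addTheta` is multiplied by a constant times a power of `q`. -/
theorem exists_addTheta_add_period (hσ : σ ≠ 0) (hτ : 0 < τ.im) (l j : ℤ) :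
    ∃ c : ℂ, c ≠ 0 ∧ ∀ x, addTheta σ τ (x + (l * σ⁻¹ + j * (τ * σ⁻¹))) =
      c * qPow σ (-(j * x)) * addTheta σ τ x := by
  have hl : ∀ x, addTheta σ τ (x + l * σ⁻¹) = addTheta σ τ x := fun x => by
    have := Function.Periodic.int_mul (f := addTheta σ τ) (addTheta_add_inv hσ) l
    exact this x
  have hj : ∀ j : ℤ, ∃ c : ℂ, c ≠ 0 ∧ ∀ x, addTheta σ τ (x + j * (τ * σ⁻¹)) =
      c * qPow σ (-(j * x)) * addTheta σ τ x := by
    intro j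
    induction j with
    | zero => exact ⟨1, one_ne_zero, by simp⟩
    | succ i ih =>
      obtain ⟨c, hc, h⟩ := ih
      refine ⟨-c * qPow σ (-(i * (τ * σ⁻¹))), mul_ne_zero (neg_ne_zero.2 hc) (qPow_ne_zero _ _),
        fun x => ?_⟩
      rw [show x + ((i + 1 : ℤ) : ℂ) * (τ * σ⁻¹) = (x + (i : ℤ) * (τ * σ⁻¹)) + τ * σ⁻¹ by
        push_cast; ring, addTheta_add_tau hσ hτ, h]
      rw [show -(((i + 1 : ℤ) : ℂ) * x) = -((i : ℤ) * x) + -x by push_cast; ring, neg_add,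
        qPow_add, qPow_add]
      push_cast
      ring
    | pred i ih =>
      obtain ⟨c, hc, h⟩ := ih
      have hne := qPow_ne_zero σ ((i + 1 : ℂ) * (τ * σ⁻¹))
      refine ⟨-c * qPow σ (-((i + 1 : ℂ) * (τ * σ⁻¹))), mul_ne_zero (neg_ne_zero.2 hc)
        (qPow_ne_zero _ _), fun x => ?_⟩
      have h1 := h x
      -- The downward step reads the τ-law backwards, from the point one period lower, and cancels
      -- its nonzero multiplier.
      rw [show x + ((-i : ℤ) : ℂ) * (τ * σ⁻¹) = (x + ((-i - 1 : ℤ) : ℂ) * (τ * σ⁻¹)) + τ * σ⁻¹ by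
        push_cast; ring, addTheta_add_tau hσ hτ] at h1
      have h2 := qPow_ne_zero σ (-(x + ((-i - 1 : ℤ) : ℂ) * (τ * σ⁻¹)))
      refine mul_left_cancel₀ (neg_ne_zero.2 h2) (h1.trans ?_)
      rw [show -c * qPow σ (-((i + 1 : ℂ) * (τ * σ⁻¹))) = -(c * qPow σ (-((i + 1 : ℂ) * (τ * σ⁻¹))))
        by ring, show ∀ a b c d e : ℂ, -a * (-(b * c) * d * e) = b * (a * c * d) * e by
        intros; ring, ← qPow_add, ← qPow_add]
      congr 3
      push_cast
      ring
  obtain ⟨c, hc, h⟩ := hj j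
  refine ⟨c, hc, fun x => ?_⟩
  rw [← h, show x + (l * σ⁻¹ + j * (τ * σ⁻¹)) = (x + j * (τ * σ⁻¹)) + l * σ⁻¹ by ring, hl]

theorem addTheta_ne_zero (hσ : σ ≠ 0) (hτ : 0 < τ.im) {x : ℂ} (hx : x ∉ periodLattice σ τ) :
    addTheta σ τ x ≠ 0 := by
  have hp := norm_nome_lt_one hτ
  have key : ∀ (n : ℤ), qPow σ (x + n * (τ * σ⁻¹)) ≠ 1 := by
    intro n h
    obtain ⟨l, hl⟩ := (qPow_eq_one_iff hσ).1 h
    exact hx (mem_periodLattice.2 ⟨l, -n, by push_cast; linear_combination hl⟩)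
  -- Nonnegative exponents n control the factors of the first product, negative ones those of the
  -- second.
  have key' : ∀ n : ℤ, qPow σ x * nome τ ^ n ≠ 1 := fun n => by
    rw [← qPow_mul_inv σ τ hσ, ← qPow_int_mul, ← qPow_add]
    exact key n
  refine mul_ne_zero (pochhammerInf_ne_zero hp fun n => by simpa using key' n)
    (pochhammerInf_ne_zero hp fun n h => key' (-(n + 1 : ℕ)) ?_)
  rw [zpow_neg, zpow_natCast, ← inv_inj, inv_one, mul_inv, inv_inv, ← h]
  ring

/-- The factor 1 - q^x has a simple zero at 0, since σ ≠ 0; the remaining factors give (p; p)_∞² ≠ 0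
there. -/
theorem meromorphicOrderAt_addTheta_zero (hσ : σ ≠ 0) (hτ : 0 < τ.im) :
    meromorphicOrderAt (addTheta σ τ) 0 = 1 := by
  have hp := norm_nome_lt_one hτ
  have hP := differentiable_pochhammerInf hp
  have hq := differentiable_qPow σ
  set g : ℂ → ℂ := fun x => pochhammerInf (nome τ * qPow σ x) (nome τ) *
    pochhammerInf (nome τ * (qPow σ x)⁻¹) (nome τ) with hg
  have hgd : Differentiable ℂ g :=
    (hP.comp (hq.const_mul _)).mul
      (hP.comp ((hq.inv fun x => qPow_ne_zero σ x).const_mul _))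
  have heq : addTheta σ τ = (fun x => 1 - qPow σ x) * g := by
    ext x
    rw [addTheta, theta, pochhammerInf_eq_mul hp (qPow σ x), Pi.mul_apply, hg, mul_assoc]
  have hpn : ∀ n : ℕ, nome τ * nome τ ^ n ≠ 1 := fun n h => by
    have := congrArg norm h
    rw [← pow_succ', norm_pow, norm_one] at this
    exact (pow_lt_one₀ (norm_nonneg _) hp n.succ_ne_zero).ne this
  have hg0 : g 0 ≠ 0 := by
    have : pochhammerInf (nome τ) (nome τ) ≠ 0 := pochhammerInf_ne_zero hp hpn
    simp [hg, this]
  have hga : AnalyticAt ℂ g 0 := hgd.analyticAt 0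
  have h1a : AnalyticAt ℂ (fun x => 1 - qPow σ x) 0 :=
    Differentiable.analyticAt (hq.const_sub 1) 0
  have hderiv : HasDerivAt (fun x => 1 - qPow σ x) (-(2 * Real.pi * Complex.I * σ)) 0 := by
    have : HasDerivAt (fun x => 2 * Real.pi * Complex.I * σ * x) (2 * Real.pi * Complex.I * σ)
      (0 : ℂ) := by simpa using (hasDerivAt_id (0 : ℂ)).const_mul (2 * Real.pi * Complex.I * σ)
    have := (this.cexp).const_sub 1
    simpa [qPow] using this
  have h1 : analyticOrderAt (fun x => 1 - qPow σ x) 0 = 1 := by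
    have := h1a.analyticOrderAt_sub_eq_one_of_deriv_ne_zero (by
      rw [hderiv.deriv]; exact neg_ne_zero.2 (mul_ne_zero Complex.two_pi_I_ne_zero hσ))
    simpa using this
  rw [heq, meromorphicOrderAt_mul h1a.meromorphicAt hga.meromorphicAt, h1a.meromorphicOrderAt_eq,
    h1, hga.meromorphicOrderAt_eq, hga.analyticOrderAt_eq_zero.2 hg0]
  rfl

open Classical in
theorem meromorphicOrderAt_addTheta (hσ : σ ≠ 0) (hτ : 0 < τ.im) (x : ℂ) :
    meromorphicOrderAt (addTheta σ τ) x = if x ∈ periodLattice σ τ then 1 else 0 := by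
  have hd := differentiable_addTheta (σ := σ) hτ
  split_ifs with hx
  · obtain ⟨l, j, rfl⟩ := mem_periodLattice.1 hx
    obtain ⟨c, hc, h⟩ := exists_addTheta_add_period hσ hτ l j
    set ω : ℂ := l * σ⁻¹ + j * (τ * σ⁻¹)
    have ha : AnalyticAt ℂ (fun x => c * qPow σ (-(j * x))) 0 :=
      (Differentiable.const_mul ((differentiable_qPow σ).comp (by fun_prop)) c).analyticAt 0
    have := meromorphicOrderAt_comp_add_const_eq_meromorphicOrderAt (x := 0) (c := ω)
      (f := addTheta σ τ)
    rw [zero_add] at this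
    rw [← this, show addTheta σ τ ∘ (· + ω) = (fun x => c * qPow σ (-(j * x))) * addTheta σ τ from
      funext h, meromorphicOrderAt_mul_of_ne_zero ha (mul_ne_zero hc (qPow_ne_zero _ _)),
      meromorphicOrderAt_addTheta_zero hσ hτ]
  · rw [(hd.analyticAt x).meromorphicOrderAt_eq,
      (hd.analyticAt x).analyticOrderAt_eq_zero.2 (addTheta_ne_zero hσ hτ hx)]
    rfl

theorem addTheta_eq_zero_iff (hσ : σ ≠ 0) (hτ : 0 < τ.im) {x : ℂ} :
    addTheta σ τ x = 0 ↔ x ∈ periodLattice σ τ := by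
  refine ⟨fun h => by_contra fun hx => addTheta_ne_zero hσ hτ hx h, fun hx => ?_⟩
  have hd := (differentiable_addTheta (σ := σ) hτ).analyticAt x
  have h1 := meromorphicOrderAt_addTheta hσ hτ x
  rw [if_pos hx] at h1
  by_contra hne
  rw [hd.meromorphicOrderAt_eq, hd.analyticOrderAt_eq_zero.2 hne] at h1
  exact zero_ne_one h1

/-! ### The parallelogram of periods -/

theorem periodic_of_mem_periodLattice {α : Type*} {h : ℂ → α} (h₁ : ∀ x, h (x + σ⁻¹) = h x)
    (h₂ : ∀ x, h (x + τ * σ⁻¹) = h x) {ω : ℂ} (hω : ω ∈ periodLattice σ τ) (x : ℂ) :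
    h (x + ω) = h x := by
  obtain ⟨l, j, rfl⟩ := mem_periodLattice.1 hω
  have hl : Function.Periodic h (l * σ⁻¹) := Function.Periodic.int_mul h₁ l
  have hj : Function.Periodic h (j * (τ * σ⁻¹)) := Function.Periodic.int_mul h₂ j
  exact hl.add_period hj x

theorem exists_mem_periodParallelogram (hσ : σ ≠ 0) (hτ : 0 < τ.im) (x : ℂ) :
    ∃ y ∈ periodParallelogram σ τ, x - y ∈ periodLattice σ τ := by
  -- Real coordinates of σx in the basis 1, τ; the imaginary part determines b because Im τ > 0.
  set b : ℝ := (σ * x).im / τ.im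
  set a : ℝ := (σ * x).re - b * τ.re
  have hx : σ * x = a + b * τ := by
    apply Complex.ext
    · simp [a]
    · simp [b, hτ.ne']
  refine ⟨(Int.fract a : ℝ) * σ⁻¹ + (Int.fract b : ℝ) * (τ * σ⁻¹),
    ⟨_, _, ⟨Int.fract_nonneg a, Int.fract_lt_one a⟩, ⟨Int.fract_nonneg b, Int.fract_lt_one b⟩, rfl⟩,
    mem_periodLattice.2 ⟨⌊a⌋, ⌊b⌋, ?_⟩⟩
  have hx' : x = (a + b * τ) * σ⁻¹ := by rw [← hx]; field_simp
  have ha : (a : ℂ) = (⌊a⌋ : ℤ) + (Int.fract a : ℝ) := by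
    exact_mod_cast (Int.floor_add_fract a).symm
  have hb : (b : ℂ) = (⌊b⌋ : ℤ) + (Int.fract b : ℝ) := by
    exact_mod_cast (Int.floor_add_fract b).symm
  rw [hx', ha, hb]
  ring

/-- The coordinates of the difference are integers strictly between -1 and 1, as the parallelogram
is half-open. -/
theorem eq_of_sub_mem_periodLattice (hσ : σ ≠ 0) (hτ : 0 < τ.im) {x y : ℂ}
    (hx : x ∈ periodParallelogram σ τ) (hy : y ∈ periodParallelogram σ τ)
    (hxy : x - y ∈ periodLattice σ τ) : x = y := by
  obtain ⟨a, b, ⟨ha0, ha1⟩, ⟨hb0, hb1⟩, rfl⟩ := hx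
  obtain ⟨a', b', ⟨ha0', ha1'⟩, ⟨hb0', hb1'⟩, rfl⟩ := hy
  obtain ⟨l, j, hlj⟩ := mem_periodLattice.1 hxy
  have key : (a - a' : ℂ) + (b - b') * τ = l + j * τ := by
    have := congrArg (· * σ) hlj
    field_simp at this
    linear_combination this
  have him := congrArg Complex.im key
  have hre := congrArg Complex.re key
  simp at him hre
  have hb : b - b' = j := by
    rcases him with h | h
    · exact h
    · exact absurd h hτ.ne'
  have hj : j = 0 := by
    have h1 : (j : ℝ) < 1 := by linarith
    have h2 : (-1 : ℝ) < j := by linarith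
    have h1' : j < 1 := by exact_mod_cast h1
    have h2' : -1 < j := by exact_mod_cast h2
    omega
  subst hj
  have hbb : b = b' := by simpa [sub_eq_zero] using hb
  subst hbb
  have ha : a - a' = l := by simpa using hre
  have hl : l = 0 := by
    have h1 : (l : ℝ) < 1 := by linarith
    have h2 : (-1 : ℝ) < l := by linarith
    have h1' : l < 1 := by exact_mod_cast h1
    have h2' : -1 < l := by exact_mod_cast h2
    omega
  subst hl
  have haa : a = a' := by simpa [sub_eq_zero] using ha
  rw [haa]

theorem exists_isCompact_periodParallelogram_subset (σ τ : ℂ) :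
    ∃ K : Set ℂ, IsCompact K ∧ periodParallelogram σ τ ⊆ K := by
  refine ⟨(fun t : ℝ × ℝ => (t.1 * σ⁻¹ + t.2 * (τ * σ⁻¹) : ℂ)) ''
    (Set.Icc 0 1 ×ˢ Set.Icc 0 1), (isCompact_Icc.prod isCompact_Icc).image (by fun_prop), ?_⟩
  rintro x ⟨a, b, ha, hb, rfl⟩
  exact ⟨(a, b), ⟨Set.Ico_subset_Icc_self ha, Set.Ico_subset_Icc_self hb⟩, rfl⟩

/-! ### Liouville's theorem -/

theorem eq_of_differentiable_of_periodic (hσ : σ ≠ 0) (hτ : 0 < τ.im) {f : ℂ → ℂ}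
    (hf : Differentiable ℂ f) (h₁ : ∀ x, f (x + σ⁻¹) = f x) (h₂ : ∀ x, f (x + τ * σ⁻¹) = f x)
    (x y : ℂ) : f x = f y := by
  obtain ⟨K, hK, hsub⟩ := exists_isCompact_periodParallelogram_subset σ τ
  refine hf.apply_eq_apply_of_bounded ((hK.image hf.continuous).isBounded.subset ?_) x y
  rintro _ ⟨x, rfl⟩
  obtain ⟨y, hy, hxy⟩ := exists_mem_periodParallelogram hσ hτ x
  refine ⟨y, hsub hy, ?_⟩
  rw [← periodic_of_mem_periodLattice h₁ h₂ hxy y, add_sub_cancel]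

theorem hasDerivAt_qPow (σ x : ℂ) :
    HasDerivAt (qPow σ) (2 * Real.pi * Complex.I * σ * qPow σ x) x := by
  have : HasDerivAt (fun x => 2 * Real.pi * Complex.I * σ * x) (2 * Real.pi * Complex.I * σ)
    x := by simpa using (hasDerivAt_id x).const_mul (2 * Real.pi * Complex.I * σ)
  have := this.cexp
  rw [mul_comm]
  exact this

/-- A nowhere vanishing entire function that is quasi-periodic with respect to the lattice of
periods is a constant multiple of an integral power of `q ^ x`. -/
theorem eq_const_mul_qPow_of_quasiperiodic (hσ : σ ≠ 0) (hτ : 0 < τ.im) {f : ℂ → ℂ}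
    (hf : Differentiable ℂ f) (hf0 : ∀ x, f x ≠ 0) (h₁ : ∀ x, f (x + σ⁻¹) = f x) {A : ℂ} {N : ℤ}
    (h₂ : ∀ x, f (x + τ * σ⁻¹) * (A * qPow σ (-(N * x))) = f x) :
    N = 0 ∧ ∃ (C : ℂ) (k : ℤ), C ≠ 0 ∧ ∀ x, f x = C * qPow σ (k * x) := by
  have hs : 2 * Real.pi * Complex.I * σ ≠ 0 := mul_ne_zero Complex.two_pi_I_ne_zero hσ
  set s : ℂ := 2 * Real.pi * Complex.I * σ with hs_def
  have hA : A ≠ 0 := by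
    rintro rfl
    exact hf0 0 (by rw [← h₂ 0]; simp)
  have hd : ∀ x, HasDerivAt f (deriv f x) x := fun x => (hf x).hasDerivAt
  have hdf : Differentiable ℂ (deriv f) := hf.deriv
  -- The logarithmic derivative turns the multiplier A q^(-Nx) into an additive constant, which a
  -- second derivative kills.
  set g : ℂ → ℂ := fun x => deriv f x / f x with hg_def
  have hg : Differentiable ℂ g := hdf.div hf hf0
  have hg₁ : ∀ x, g (x + σ⁻¹) = g x := fun x => by
    have h := (hd (x + σ⁻¹)).comp_add_const x σ⁻¹
    simp only [h₁] at h
    rw [hg_def]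
    simp only [h₁, h.unique (hd x)]
  have hg₂ : ∀ x, g (x + τ * σ⁻¹) = g x + s * N := fun x => by
    have h := (hd (x + τ * σ⁻¹)).comp_add_const x (τ * σ⁻¹)
    have hq : HasDerivAt (fun x => A * qPow σ (-(N * x))) (A * (s * qPow σ (-(N * x)) * -N)) x := by
      refine HasDerivAt.const_mul A ?_
      have hlin : HasDerivAt (fun x : ℂ => -((N : ℂ) * x)) (-N) x := by
        simpa using ((hasDerivAt_id x).const_mul (N : ℂ)).fun_neg
      exact HasDerivAt.comp (h₂ := qPow σ) x (hasDerivAt_qPow σ (-(N * x))) hlin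
    have h3 := h.mul hq
    have h4 : HasDerivAt f _ x := h3.congr_of_eventuallyEq (.of_forall fun y => (h₂ y).symm)
    have h5 := (hd x).unique h4
    have hqne := qPow_ne_zero σ (-(N * x))
    have hfx := h₂ x
    have hne := hf0 (x + τ * σ⁻¹)
    rw [hg_def]
    simp only [h5]
    rw [← hfx]
    generalize x + τ * σ⁻¹ = y at hne ⊢
    generalize qPow σ (-(N * x)) = w at hqne ⊢
    field_simp
    ring
  have hg'₁ : ∀ x, deriv g (x + σ⁻¹) = deriv g x := fun x => by
    have h := ((hg (x + σ⁻¹)).hasDerivAt).comp_add_const x σ⁻¹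
    simp only [hg₁] at h
    exact h.unique (hg x).hasDerivAt
  have hg'₂ : ∀ x, deriv g (x + τ * σ⁻¹) = deriv g x := fun x => by
    have h := ((hg (x + τ * σ⁻¹)).hasDerivAt).comp_add_const x (τ * σ⁻¹)
    simp only [hg₂] at h
    exact h.unique ((hg x).hasDerivAt.add_const _)
  have hconst := eq_of_differentiable_of_periodic hσ hτ hg.deriv hg'₁ hg'₂
  set a := deriv g 0 with ha_def
  have hlin : ∀ x, g x = a * x + g 0 := by
    have : ∀ x, HasDerivAt (fun x => g x - a * x) 0 x := fun x => by
      have := (hg x).hasDerivAt.sub ((hasDerivAt_id x).const_mul a)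
      rw [hconst x 0, ← ha_def, mul_one, sub_self] at this
      exact this
    intro x
    have h := is_const_of_deriv_eq_zero (fun x => (this x).differentiableAt)
      (fun x => (this x).deriv) x 0
    simp only [mul_zero, sub_zero] at h
    linear_combination h
  -- A linear function with period σ⁻¹ has slope zero; the increment s * N under the other period
  -- must then vanish too.
  have ha : a = 0 := by
    have h := hg₁ 0
    rw [hlin, hlin 0] at h
    have : a * σ⁻¹ = 0 := by linear_combination h
    exact (mul_eq_zero.1 this).resolve_right (inv_ne_zero hσ)
  have hgc : ∀ x, g x = g 0 := fun x => by rw [hlin, ha, zero_mul, zero_add]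
  have hN : N = 0 := by
    have h := hg₂ 0
    rw [hgc] at h
    have : s * N = 0 := by linear_combination -h
    exact_mod_cast (mul_eq_zero.1 this).resolve_left hs
  refine ⟨hN, ?_⟩
  have hf_exp : ∀ x, f x = f 0 * Complex.exp (g 0 * x) := by
    have : ∀ x, HasDerivAt (fun x => f x * Complex.exp (-(g 0 * x))) 0 x := fun x => by
      have hl : HasDerivAt (fun x => -(g 0 * x)) (-g 0) x := by
        simpa using ((hasDerivAt_id x).const_mul (g 0)).fun_neg
      have := (hd x).mul hl.cexp
      have h0 : deriv f x = g 0 * f x := by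
        rw [← hgc x, hg_def]
        exact (div_mul_cancel₀ _ (hf0 x)).symm
      rw [h0] at this
      refine this.congr_deriv ?_
      ring
    intro x
    have h := is_const_of_deriv_eq_zero (fun x => (this x).differentiableAt)
      (fun x => (this x).deriv) x 0
    simp only [mul_zero, neg_zero, Complex.exp_zero, mul_one, Complex.exp_neg] at h
    rw [← h, inv_mul_cancel_right₀ (Complex.exp_ne_zero _)]
  -- Period σ⁻¹ of f quantizes the exponent, giving the integer k.
  have h1 : Complex.exp (g 0 * σ⁻¹) = 1 := by
    have h := h₁ 0
    rw [zero_add, hf_exp] at h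
    exact mul_left_cancel₀ (hf0 0) (by rw [h, mul_one])
  obtain ⟨k, hk⟩ := Complex.exp_eq_one_iff.1 h1
  refine ⟨f 0, k, hf0 0, fun x => ?_⟩
  rw [hf_exp x, qPow]
  congr 2
  have : g 0 = k * (2 * Real.pi * Complex.I) * σ := by
    rw [← hk]
    field_simp
  rw [this]
  ring

/-! ### Enumeration of zeros and poles -/

/-- Turns a divisor with multiplicities into a list of parameters, retaining only what is needed:
membership, products and the sum. -/
theorem exists_enumeration (s : Finset ℂ) (m : ℂ → ℕ) {n : ℕ} (hn : ∑ a ∈ s, m a = n) :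
    ∃ u : Fin n → ℂ, (∀ i, u i ∈ s ∧ m (u i) ≠ 0) ∧
      (∀ f : ℂ → ℂ, ∏ i, f (u i) = ∏ a ∈ s, f a ^ m a) ∧ ∑ i, u i = ∑ a ∈ s, m a * a := by
  obtain ⟨l, hl⟩ : ∃ l : List ℂ, (l : Multiset ℂ) = ∑ a ∈ s, Multiset.replicate (m a) a :=
    Quot.exists_rep _
  have hlen : l.length = n := by
    rw [← Multiset.coe_card, hl, Multiset.card_sum, ← hn]
    simp
  subst hlen
  refine ⟨l.get, fun i => ?_, fun f => ?_, ?_⟩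
  · have : l.get i ∈ (l : Multiset ℂ) := Multiset.mem_coe.2 (l.get_mem i)
    rw [hl, Multiset.mem_sum] at this
    obtain ⟨a, ha, hia⟩ := this
    obtain ⟨h1, h2⟩ := Multiset.mem_replicate.1 hia
    rw [h2]
    exact ⟨ha, h1⟩
  · have h1 : ∏ i, f (l.get i) = ((l : Multiset ℂ).map f).prod := by
      rw [Multiset.map_coe, Multiset.prod_coe]
      exact Fin.prod_univ_fun_getElem l f
    rw [h1, hl, ← Multiset.coe_mapAddMonoidHom, map_sum, Multiset.prod_sum]
    simp
  · have h1 : ∑ i, l.get i = Multiset.sum (l : Multiset ℂ) := by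
      rw [Multiset.sum_coe]
      exact Fin.sum_univ_getElem l
    rw [h1, hl, Multiset.sum_sum]
    simp

theorem eventually_nhdsNE_add {p : ℂ → Prop} {x : ℂ} (ω : ℂ) (h : ∀ᶠ y in 𝓝[≠] (x + ω), p y) :
    ∀ᶠ y in 𝓝[≠] x, p (y + ω) := by
  have ht : Tendsto (· + ω) (𝓝[≠] x) (𝓝[≠] (x + ω)) :=
    tendsto_nhdsWithin_of_tendsto_nhds_of_eventually_within _
      ((continuous_add_const ω).continuousAt.tendsto.mono_left nhdsWithin_le_nhds)
      (eventually_nhdsWithin_of_forall fun y hy => by simpa using hy)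
  exact ht.eventually h

theorem eq_of_eventuallyEq_nhdsNE {f g : ℂ → ℂ} {x : ℂ} (hf : ContinuousAt f x)
    (hg : ContinuousAt g x) (h : f =ᶠ[𝓝[≠] x] g) : f x = g x :=
  tendsto_nhds_unique_of_eventuallyEq (hf.tendsto.mono_left nhdsWithin_le_nhds)
    (hg.tendsto.mono_left nhdsWithin_le_nhds) h

theorem prod_zpow_eq_zpow_sum {ι : Type*} {x : ℂ} (hx : x ≠ 0) (s : Finset ι) (n : ι → ℤ) :
    ∏ i ∈ s, x ^ n i = x ^ ∑ i ∈ s, n i := by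
  classical
  induction s using Finset.induction with
  | empty => simp
  | insert a s ha ih => rw [Finset.prod_insert ha, Finset.sum_insert ha, ih, zpow_add₀ hx]

theorem zpow_eq_pow_toNat_div (x : ℂ) (n : ℤ) : x ^ n = x ^ n.toNat / x ^ (-n).toNat := by
  rcases le_total 0 n with h | h
  · obtain ⟨k, rfl⟩ := Int.eq_ofNat_of_zero_le h
    simp
  · obtain ⟨k, hk⟩ := Int.eq_ofNat_of_zero_le (neg_nonneg.2 h)
    obtain rfl : n = -k := by omega
    simp

/-! ### Products of theta functions -/

/-- The product `∏ θ(q ^ (x - a); p) ^ n a` over `a ∈ S`. -/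
def thetaProduct (σ τ : ℂ) (S : Finset ℂ) (n : ℂ → ℤ) (x : ℂ) : ℂ :=
  ∏ a ∈ S, addTheta σ τ (x - a) ^ n a

theorem meromorphicAt_addTheta_sub_zpow (hτ : 0 < τ.im) (a : ℂ) (n : ℤ) (x : ℂ) :
    MeromorphicAt (fun x => addTheta σ τ (x - a) ^ n) x := by
  have h : Differentiable ℂ fun x => addTheta σ τ (x - a) :=
    (differentiable_addTheta hτ).comp (differentiable_id.sub_const a)
  exact (h.analyticAt x).meromorphicAt.fun_zpow n

theorem meromorphicAt_thetaProduct (hτ : 0 < τ.im) (S : Finset ℂ) (n : ℂ → ℤ) (x : ℂ) :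
    MeromorphicAt (thetaProduct σ τ S n) x :=
  MeromorphicAt.fun_prod fun a _ => meromorphicAt_addTheta_sub_zpow hτ a (n a) x

/-- Distinct points of S are inequivalent modulo periods, so only the factor of the representative y
can vanish at x. -/
theorem meromorphicOrderAt_thetaProduct (hσ : σ ≠ 0) (hτ : 0 < τ.im) {S : Finset ℂ} {n : ℂ → ℤ}
    (hS : (S : Set ℂ) ⊆ periodParallelogram σ τ)
    (hn : ∀ a ∈ periodParallelogram σ τ, a ∉ S → n a = 0)
    {x y : ℂ} (hy : y ∈ periodParallelogram σ τ) (hxy : x - y ∈ periodLattice σ τ) :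
    meromorphicOrderAt (thetaProduct σ τ S n) x = n y := by
  classical
  unfold thetaProduct
  rw [meromorphicOrderAt_fun_prod fun a _ => meromorphicAt_addTheta_sub_zpow hτ a (n a) x]
  have h1 : ∀ a ∈ S, meromorphicOrderAt (fun x => addTheta σ τ (x - a) ^ n a) x =
      if a = y then (n y : WithTop ℤ) else 0 := by
    intro a ha
    have hd : Differentiable ℂ fun x => addTheta σ τ (x - a) :=
      (differentiable_addTheta hτ).comp (differentiable_id.sub_const a)
    rw [fun_meromorphicOrderAt_zpow (hd.analyticAt x).meromorphicAt,
      meromorphicOrderAt_fun_comp_sub_const_eq_meromorphicOrderAt,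
      meromorphicOrderAt_addTheta hσ hτ]
    have : x - a ∈ periodLattice σ τ ↔ a = y := by
      constructor
      · intro h
        refine eq_of_sub_mem_periodLattice hσ hτ (hS ha) hy ?_
        simpa using (periodLattice σ τ).sub_mem hxy h
      · rintro rfl
        exact hxy
    by_cases h : a = y
    · rw [if_pos (this.2 h), if_pos h, h, mul_one]
    · simp [this, h]
  rw [Finset.sum_congr rfl h1, Finset.sum_ite_eq']
  split_ifs with h
  · rfl
  · rw [hn y hy h]
    rfl

theorem thetaProduct_add_inv (hσ : σ ≠ 0) (S : Finset ℂ) (n : ℂ → ℤ) (x : ℂ) :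
    thetaProduct σ τ S n (x + σ⁻¹) = thetaProduct σ τ S n x := by
  refine Finset.prod_congr rfl fun a _ => ?_
  rw [add_sub_right_comm, addTheta_add_inv hσ]

theorem thetaProduct_add_tau (hσ : σ ≠ 0) (hτ : 0 < τ.im) (S : Finset ℂ) (n : ℂ → ℤ) (x : ℂ) :
    thetaProduct σ τ S n (x + τ * σ⁻¹) =
      ((∏ a ∈ S, (-qPow σ a) ^ n a) * qPow σ (-((∑ a ∈ S, n a : ℤ) * x))) *
        thetaProduct σ τ S n x := by
  rw [show -(((∑ a ∈ S, n a : ℤ) : ℂ) * x) = ((∑ a ∈ S, n a : ℤ) : ℂ) * -x by ring, qPow_int_mul,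
    ← prod_zpow_eq_zpow_sum (qPow_ne_zero σ _), thetaProduct, thetaProduct,
    ← Finset.prod_mul_distrib, ← Finset.prod_mul_distrib]
  refine Finset.prod_congr rfl fun a _ => ?_
  rw [add_sub_right_comm, addTheta_add_tau hσ hτ, ← mul_zpow, ← mul_zpow,
    show -(x - a) = a + -x by ring, qPow_add]
  ring_nf

/-! ### Factorization of elliptic functions -/

theorem IsElliptic.meromorphicOrderAt_add {h : ℂ → ℂ} (hell : IsElliptic σ τ h) {ω : ℂ}
    (hω : ω ∈ periodLattice σ τ) (x : ℂ) :
    meromorphicOrderAt h (x + ω) = meromorphicOrderAt h x := by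
  rw [← meromorphicOrderAt_comp_add_const_eq_meromorphicOrderAt]
  congr 1
  exact funext fun y =>
    periodic_of_mem_periodLattice hell.periodic_one hell.periodic_tau hω y

/-- By the identity theorem, order ⊤ at one point means ⊤ everywhere; `untop₀` sends ⊤ to 0, so no
pole would be counted. -/
theorem meromorphicOrderAt_ne_top_of_ellipticOrder_ne_zero {h : ℂ → ℂ} (hmer : Meromorphic h)
    (hord : ellipticOrder σ τ h ≠ 0) (x : ℂ) : meromorphicOrderAt h x ≠ ⊤ := by
  refine hmer.exists_meromorphicOrderAt_ne_top_iff_forall.1 ?_ x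
  by_contra! hall
  refine hord ?_
  simp [ellipticOrder, poleMultiplicity, hall]

theorem finite_meromorphicOrderAt_ne_zero {h : ℂ → ℂ} (hmer : Meromorphic h) :
    {a ∈ periodParallelogram σ τ | (meromorphicOrderAt h a).untop₀ ≠ 0}.Finite := by
  obtain ⟨K, hK, hsub⟩ := exists_isCompact_periodParallelogram_subset σ τ
  refine ((MeromorphicOn.divisor h K).finiteSupport hK).subset ?_
  rintro a ⟨ha, hna⟩
  rw [Function.mem_support, MeromorphicOn.divisor_apply (fun x _ => hmer x) (hsub ha)]
  exact hna

/-- The integer k occurs both in the exponential factor and in the Abel relation; this coincidence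
gives the balancing later. Equality is asserted on punctured neighbourhoods because the values of h
at its poles are arbitrary. -/
theorem IsElliptic.exists_eq_mul_thetaProduct (hσ : σ ≠ 0) (hτ : 0 < τ.im) {h : ℂ → ℂ}
    (hell : IsElliptic σ τ h) (hne : ∀ x, meromorphicOrderAt h x ≠ ⊤) {S : Finset ℂ}
    (hS : ∀ a, a ∈ S ↔ a ∈ periodParallelogram σ τ ∧ (meromorphicOrderAt h a).untop₀ ≠ 0) :
    ∑ a ∈ S, (meromorphicOrderAt h a).untop₀ = 0 ∧ ∃ (C : ℂ) (k l : ℤ), C ≠ 0 ∧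
      ∑ a ∈ S, ((meromorphicOrderAt h a).untop₀ : ℂ) * a = l * σ⁻¹ + -k * (τ * σ⁻¹) ∧
      ∀ x, h =ᶠ[𝓝[≠] x] fun y => C * qPow σ (k * y) *
        thetaProduct σ τ S (fun a => (meromorphicOrderAt h a).untop₀) y := by
  set n : ℂ → ℤ := fun a => (meromorphicOrderAt h a).untop₀ with hn_def
  have hn : ∀ a, meromorphicOrderAt h a = n a := fun a =>
    (WithTop.coe_untop₀_of_ne_top (hne a)).symm
  set K := thetaProduct σ τ S n with hK_def
  have hKm : ∀ x, MeromorphicAt K x := meromorphicAt_thetaProduct hτ S n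
  have hKord : ∀ x, meromorphicOrderAt K x = n x := fun x => by
    obtain ⟨y, hy, hxy⟩ := exists_mem_periodParallelogram hσ hτ x
    rw [meromorphicOrderAt_thetaProduct hσ hτ (fun a ha => ((hS a).1 ha).1) ?_ hy hxy, ← hn, ← hn,
      ← hell.meromorphicOrderAt_add hxy y, add_sub_cancel]
    intro a ha haS
    by_contra hna
    exact haS ((hS a).2 ⟨ha, hna⟩)
  have hKne : ∀ x, ∀ᶠ y in 𝓝[≠] x, K y ≠ 0 := fun x =>
    (meromorphicOrderAt_ne_top_iff_eventually_ne_zero (hKm x)).1 (by rw [hKord]; simp)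
  have hmer : MeromorphicOn (h / K) Set.univ := fun x _ => (hell.meromorphic x).div (hKm x)
  -- Passing to the normal form removes the singularities of the quotient, which has order 0
  -- everywhere.
  set f := toMeromorphicNFOn (h / K) Set.univ with hf_def
  have hfNF : ∀ x, MeromorphicNFAt f x := fun x =>
    meromorphicNFOn_toMeromorphicNFOn (h / K) Set.univ (Set.mem_univ x)
  have hford : ∀ x, meromorphicOrderAt f x = 0 := fun x => by
    rw [meromorphicOrderAt_toMeromorphicNFOn hmer (Set.mem_univ x),
      meromorphicOrderAt_div (hell.meromorphic x) (hKm x), hKord, hn]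
    exact_mod_cast congrArg (WithTop.some) (sub_self (n x))
  have hfd : Differentiable ℂ f := fun x =>
    ((hfNF x).meromorphicOrderAt_nonneg_iff_analyticAt.1 (hford x).ge).differentiableAt
  have hf0 : ∀ x, f x ≠ 0 := fun x => (hfNF x).meromorphicOrderAt_eq_zero_iff.1 (hford x)
  have hfac : ∀ x, ∀ᶠ y in 𝓝[≠] x, K y ≠ 0 ∧ h y = f y * K y := fun x => by
    filter_upwards [hmer.toMeromorphicNFOn_eq_self_on_nhdsNE (Set.mem_univ x), hKne x] with y hy hKy
    refine ⟨hKy, ?_⟩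
    rw [hf_def, hy, Pi.div_apply, div_mul_cancel₀ _ hKy]
  have h₁ : ∀ x, f (x + σ⁻¹) = f x := fun x => by
    refine eq_of_eventuallyEq_nhdsNE (f := fun x => f (x + σ⁻¹))
      (hfd.continuous.comp (continuous_add_const _)).continuousAt hfd.continuous.continuousAt ?_
    filter_upwards [hfac x, eventually_nhdsNE_add _ (hfac (x + σ⁻¹))] with y hy hy'
    have := hy'.2
    rw [hell.periodic_one, hy.2, hK_def, thetaProduct_add_inv hσ] at this
    exact (mul_right_cancel₀ hy.1 this).symm
  set A : ℂ := ∏ a ∈ S, (-qPow σ a) ^ n a with hA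
  set N : ℤ := ∑ a ∈ S, n a with hN
  have hqc : Continuous fun x => A * qPow σ (-(N * x)) :=
    continuous_const.mul ((differentiable_qPow σ).continuous.comp (by fun_prop))
  have h₂ : ∀ x, f (x + τ * σ⁻¹) * (A * qPow σ (-(N * x))) = f x := fun x => by
    refine eq_of_eventuallyEq_nhdsNE (f := fun x => f (x + τ * σ⁻¹) * (A * qPow σ (-(N * x))))
      ((hfd.continuous.comp (continuous_add_const _)).mul hqc).continuousAt
      hfd.continuous.continuousAt ?_
    filter_upwards [hfac x, eventually_nhdsNE_add _ (hfac (x + τ * σ⁻¹))] with y hy hy'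
    have := hy'.2
    rw [hell.periodic_tau, hy.2, hK_def, thetaProduct_add_tau hσ hτ, ← mul_assoc] at this
    exact (mul_right_cancel₀ hy.1 this).symm
  obtain ⟨hN0, C, k, hC, hfC⟩ := eq_const_mul_qPow_of_quasiperiodic hσ hτ hfd hf0 h₁ h₂
  -- The signs multiply to (-1)^N = 1.
  have hA' : A = qPow σ (∑ a ∈ S, (n a : ℂ) * a) := by
    have : ∀ a ∈ S, (-qPow σ a) ^ n a = (-1) ^ n a * qPow σ (n a * a) := fun a _ => by
      rw [qPow_int_mul, ← mul_zpow, neg_one_mul]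
    rw [qPow_sum, hA, Finset.prod_congr rfl this, Finset.prod_mul_distrib,
      prod_zpow_eq_zpow_sum (by norm_num), ← hN, hN0, zpow_zero, one_mul]
  have h1 : qPow σ (k * (τ * σ⁻¹) + ∑ a ∈ S, (n a : ℂ) * a) = 1 := by
    have h := h₂ 0
    rw [hfC, hfC, hA'] at h
    simp only [mul_zero, neg_zero, qPow_zero, mul_one, zero_add] at h
    rw [qPow_add]
    exact mul_left_cancel₀ hC (by rw [mul_one, ← mul_assoc, h])
  obtain ⟨l, hl⟩ := (qPow_eq_one_iff hσ).1 h1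
  refine ⟨hN0, C, k, l, hC, by linear_combination hl, fun x => ?_⟩
  filter_upwards [hfac x] with y hy
  rw [hy.2, hfC]

/-- An elliptic function of order `r + 1` is a quotient of products of `r + 1` theta functions
without common zeros, with balanced parameters. -/
theorem IsElliptic.exists_eq_theta_quotient (hσ : σ ≠ 0) (hτ : 0 < τ.im) {h : ℂ → ℂ}
    (hell : IsElliptic σ τ h) {r : ℕ} (hord : ellipticOrder σ τ h = r + 1) :
    ∃ (u v : Fin (r + 1) → ℂ) (z : ℂ), z ≠ 0 ∧ ∑ m, u m = ∑ k, v k ∧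
      (∀ m k, u m - v k ∉ periodLattice σ τ) ∧
      ∀ x, h =ᶠ[𝓝[≠] x] fun y =>
        z * ((∏ m, addTheta σ τ (y + u m)) / ∏ k, addTheta σ τ (y + v k)) := by
  have hne := meromorphicOrderAt_ne_top_of_ellipticOrder_ne_zero hell.meromorphic
    (by rw [hord]; exact r.succ_ne_zero)
  have hfin := finite_meromorphicOrderAt_ne_zero (σ := σ) (τ := τ) hell.meromorphic
  set S := hfin.toFinset with hS_def
  have hS : ∀ a, a ∈ S ↔ a ∈ periodParallelogram σ τ ∧ (meromorphicOrderAt h a).untop₀ ≠ 0 :=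
    fun a => by rw [hS_def, Set.Finite.mem_toFinset]; rfl
  obtain ⟨hN, C, k, l, hC, hsum, hfac⟩ := hell.exists_eq_mul_thetaProduct hσ hτ hne hS
  set n : ℂ → ℤ := fun a => (meromorphicOrderAt h a).untop₀ with hn_def
  have hpoles : ∑ a ∈ S, (-n a).toNat = r + 1 := by
    rw [← hord, ellipticOrder]
    refine (finsum_mem_eq_sum_of_inter_support_eq _ ?_).symm
    ext a
    simp only [Set.mem_inter_iff, Function.mem_support, Finset.mem_coe, hS]
    refine ⟨fun h => ⟨⟨h.1, fun h0 => h.2 (by rw [hn_def]; simp [h0])⟩, h.2⟩, fun h => ⟨h.1.1, h.2⟩⟩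
  have hzeros : ∑ a ∈ S, (n a).toNat = r + 1 := by
    have h1 : ∑ a ∈ S, (((n a).toNat : ℤ) - ((-n a).toNat : ℤ)) = 0 := by
      rw [← hN]
      exact Finset.sum_congr rfl fun a _ => Int.toNat_sub_toNat_neg (n a)
    rw [Finset.sum_sub_distrib] at h1
    have h2 : ((∑ a ∈ S, (n a).toNat : ℕ) : ℤ) = (∑ a ∈ S, (-n a).toNat : ℕ) := by
      push_cast
      linarith
    rw [← hpoles]
    exact_mod_cast h2
  obtain ⟨u, hu, hu_prod, hu_sum⟩ := exists_enumeration S (fun a => (n a).toNat) hzeros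
  obtain ⟨v, hv, hv_prod, hv_sum⟩ := exists_enumeration S (fun a => (-n a).toNat) hpoles
  have hK : ∀ y, thetaProduct σ τ S n y =
      (∏ m, addTheta σ τ (y - u m)) / ∏ m, addTheta σ τ (y - v m) := fun y => by
    rw [hu_prod fun a => addTheta σ τ (y - a), hv_prod fun a => addTheta σ τ (y - a),
      ← Finset.prod_div_distrib]
    exact Finset.prod_congr rfl fun a _ => zpow_eq_pow_toNat_div _ _
  have huv : ∑ m, u m - ∑ m, v m = l * σ⁻¹ + (-k : ℤ) * (τ * σ⁻¹) := by
    rw [hu_sum, hv_sum, ← Finset.sum_sub_distrib]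
    push_cast
    rw [← hsum]
    refine Finset.sum_congr rfl fun a _ => ?_
    rw [← sub_mul]
    congr 1
    exact_mod_cast congrArg (Int.cast (R := ℂ)) (Int.toNat_sub_toNat_neg (n a))
  set ω : ℂ := l * σ⁻¹ + (-k : ℤ) * (τ * σ⁻¹) with hω_def
  have hω : ω ∈ periodLattice σ τ := mem_periodLattice.2 ⟨l, -k, rfl⟩
  obtain ⟨c, hc, hshift⟩ := exists_addTheta_add_period hσ hτ l (-k)
  -- A point cannot have both positive and negative order.
  have hdisj : ∀ m j, v j - u m ∉ periodLattice σ τ := fun m j hmem => by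
    have heq := eq_of_sub_mem_periodLattice hσ hτ ((hS _).1 (hv j).1).1 ((hS _).1 (hu m).1).1 hmem
    have h1 := (hv j).2
    have h2 := (hu m).2
    rw [heq] at h1
    omega
  -- Parameters are negatives of zeros and poles, and ∑ u - ∑ v = ω, so adding ω to one parameter
  -- balances them. The shifted theta factor gains c q^(k(y - u 0)); this supplies q^(ky), and z
  -- compensates the constant left over.
  refine ⟨Fin.cons (-u 0 + ω) fun m => -u m.succ, fun m => -v m,
    C / (c * qPow σ (-(k * u 0))), div_ne_zero hC (mul_ne_zero hc (qPow_ne_zero _ _)), ?_, ?_, ?_⟩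
  · rw [Fin.sum_univ_succ] at huv ⊢
    simp only [Fin.cons_zero, Fin.cons_succ, Finset.sum_neg_distrib]
    linear_combination -huv
  · intro m j hmem
    refine Fin.cases ?_ (fun m => ?_) m hmem
    · intro h0
      refine hdisj 0 j ?_
      have := (periodLattice σ τ).sub_mem h0 hω
      simp only [Fin.cons_zero] at this
      convert this using 1
      ring
    · intro h0
      refine hdisj m.succ j ?_
      simp only [Fin.cons_succ] at h0
      convert h0 using 1
      ring
  · intro x
    filter_upwards [hfac x] with y hy
    rw [hy, hK, Fin.prod_univ_succ, Fin.prod_univ_succ (fun m => addTheta σ τ (y + _))]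
    simp only [Fin.cons_zero, Fin.cons_succ, ← sub_eq_add_neg]
    rw [show y + (-u 0 + ω) = (y - u 0) + ω by ring, hω_def, hshift,
      show (-(((-k : ℤ) : ℂ) * (y - u 0))) = k * y + -(k * u 0) by push_cast; ring, qPow_add]
    have h1 := qPow_ne_zero σ (-(k * u 0))
    field_simp

/-! ### Values of theta quotients -/

theorem continuous_prod_addTheta (hτ : 0 < τ.im) {n : ℕ} (u : Fin n → ℂ) :
    Continuous fun x => ∏ m, addTheta σ τ (x + u m) :=
  continuous_finsetProd _ fun m _ =>
    (differentiable_addTheta hτ).continuous.comp (continuous_add_const (u m))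

theorem eventually_prod_addTheta_ne_zero (hσ : σ ≠ 0) (hτ : 0 < τ.im) {n : ℕ} (u : Fin n → ℂ)
    (x : ℂ) : ∀ᶠ y in 𝓝[≠] x, ∏ m, addTheta σ τ (y + u m) ≠ 0 := by
  have h : ∀ m, ∀ᶠ y in 𝓝[≠] x, addTheta σ τ (y + u m) ≠ 0 := fun m => by
    refine eventually_nhdsNE_add (u m) ((meromorphicOrderAt_ne_top_iff_eventually_ne_zero
      ((differentiable_addTheta hτ).analyticAt _).meromorphicAt).1 ?_)
    rw [meromorphicOrderAt_addTheta hσ hτ]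
    split_ifs
    · exact WithTop.one_ne_top
    · exact WithTop.zero_ne_top
  filter_upwards [eventually_all.2 h] with y hy
  exact Finset.prod_ne_zero_iff.2 fun m _ => hy m

/-- Where a theta quotient without common zeros has a finite limit, its denominator does not vanish
and the limit is the value. -/
theorem eq_of_tendsto_theta_quotient (hσ : σ ≠ 0) (hτ : 0 < τ.im) {n : ℕ} {u v : Fin n → ℂ} {z : ℂ}
    (hz : z ≠ 0) (hdisj : ∀ m k, u m - v k ∉ periodLattice σ τ) {h : ℂ → ℂ} {x a : ℂ}
    (heq : h =ᶠ[𝓝[≠] x] fun y =>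
      z * ((∏ m, addTheta σ τ (y + u m)) / ∏ k, addTheta σ τ (y + v k)))
    (ha : Tendsto h (𝓝[≠] x) (𝓝 a)) :
    (∀ k, addTheta σ τ (x + v k) ≠ 0) ∧
      a = z * ((∏ m, addTheta σ τ (x + u m)) / ∏ k, addTheta σ τ (x + v k)) := by
  have hN := (continuous_prod_addTheta (σ := σ) hτ u).continuousAt (x := x)
  have hD := (continuous_prod_addTheta (σ := σ) hτ v).continuousAt (x := x)
  have key : a * ∏ k, addTheta σ τ (x + v k) = z * ∏ m, addTheta σ τ (x + u m) := by
    refine tendsto_nhds_unique_of_eventuallyEq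
      (ha.mul (hD.tendsto.mono_left nhdsWithin_le_nhds))
      ((hN.tendsto.mono_left nhdsWithin_le_nhds).const_mul z) ?_
    filter_upwards [heq, eventually_prod_addTheta_ne_zero hσ hτ v x] with y hy hy0
    rw [hy, mul_assoc, div_mul_cancel₀ _ hy0]
  -- A vanishing denominator would force the numerator to vanish at x by `key`, contradicting the
  -- absence of common zeros.
  have hv : ∀ k, addTheta σ τ (x + v k) ≠ 0 := fun k hk => by
    rw [Finset.prod_eq_zero (Finset.mem_univ k) hk, mul_zero, eq_comm, mul_eq_zero,
      or_iff_right hz, Finset.prod_eq_zero_iff] at key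
    obtain ⟨m, -, hm⟩ := key
    have h1 := (addTheta_eq_zero_iff hσ hτ).1 hk
    have h2 := (addTheta_eq_zero_iff hσ hτ).1 hm
    refine hdisj m k ?_
    simpa using (periodLattice σ τ).sub_mem h2 h1
  refine ⟨hv, ?_⟩
  rw [← mul_div_assoc, ← key, mul_div_cancel_right₀]
  exact Finset.prod_ne_zero_iff.2 fun k _ => hv k

/-- Otherwise the quotient is continuous at P and h has a finite limit there. -/
theorem exists_add_mem_periodLattice_of_pole (hσ : σ ≠ 0) (hτ : 0 < τ.im) {n : ℕ}
    {u v : Fin n → ℂ} {z : ℂ} {h : ℂ → ℂ} {P : ℂ}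
    (heq : h =ᶠ[𝓝[≠] P] fun y =>
      z * ((∏ m, addTheta σ τ (y + u m)) / ∏ k, addTheta σ τ (y + v k)))
    (hP : meromorphicOrderAt h P < 0) : ∃ k, P + v k ∈ periodLattice σ τ := by
  by_contra! hall
  have hD : ∏ k, addTheta σ τ (P + v k) ≠ 0 :=
    Finset.prod_ne_zero_iff.2 fun k _ => addTheta_ne_zero hσ hτ (hall k)
  have hc := ((continuous_prod_addTheta (σ := σ) hτ u).continuousAt.div
    (continuous_prod_addTheta (σ := σ) hτ v).continuousAt hD).const_mul z
  have ht := (hc.tendsto.mono_left (nhdsWithin_le_nhds (s := {P}ᶜ))).congr' heq.symm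
  exact not_le.2 hP ((tendsto_nhds_iff_meromorphicOrderAt_nonneg
    (meromorphicAt_of_meromorphicOrderAt_ne_zero hP.ne)).1 ⟨_, ht⟩)

/-! ### Terms and ratios of the series -/

theorem qPow_one_zpow (σ : ℂ) (n : ℤ) : qPow σ 1 ^ n = qPow σ n := by
  rw [← qPow_int_mul, mul_one]

theorem thetaPochhammerNat_succ (t p q : ℂ) (n : ℕ) :
    thetaPochhammerNat t p q (n + 1) = thetaPochhammerNat t p q n * theta (t * q ^ n) p :=
  Finset.prod_range_succ _ _

theorem thetaPochhammer_neg (t p q : ℂ) (n : ℕ) :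
    thetaPochhammer t p q (-n) = (thetaPochhammerNat (t * q ^ (-n : ℤ)) p q n)⁻¹ := by
  cases n with
  | zero =>
    change thetaPochhammerNat _ _ _ 0 = _
    simp [thetaPochhammerNat]
  | succ n => exact one_div _

theorem thetaPochhammer_eq_mul_inv {q : ℂ} (hq : q ≠ 0) (t p : ℂ) {n : ℤ} (hn : n < 0) :
    thetaPochhammer t p q n = thetaPochhammer t p q (n + 1) * (theta (t * q ^ n) p)⁻¹ := by
  obtain ⟨k, rfl⟩ : ∃ k : ℕ, n = -((k + 1 : ℕ) : ℤ) := ⟨(-n - 1).toNat, by omega⟩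
  rw [show -((k + 1 : ℕ) : ℤ) + 1 = -(k : ℤ) by push_cast; ring, thetaPochhammer_neg,
    thetaPochhammer_neg, ← mul_inv, thetaPochhammerNat, Finset.prod_range_succ', pow_zero, mul_one,
    thetaPochhammerNat]
  congr 2
  refine Finset.prod_congr rfl fun m _ => ?_
  rw [mul_assoc, mul_assoc, ← zpow_natCast, ← zpow_natCast, ← zpow_add₀ hq, ← zpow_add₀ hq]
  congr 3
  push_cast
  ring

theorem thetaPochhammer_add_one (t p q : ℂ) {n : ℤ} (hn : 0 ≤ n) :
    thetaPochhammer t p q (n + 1) = thetaPochhammer t p q n * theta (t * q ^ n) p := by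
  obtain ⟨k, rfl⟩ := Int.eq_ofNat_of_zero_le hn
  rw [zpow_natCast]
  exact thetaPochhammerNat_succ t p q k

theorem termE_succ {r s : ℕ} (t : Fin r → ℂ) (w : Fin s → ℂ) (z : ℂ) (n : ℕ) :
    termE σ τ t w 0 z (n + 1) = ratioE σ τ t w 0 z n * termE σ τ t w 0 z n := by
  have hq : qPow σ 1 ^ n = qPow σ n := by simpa using qPow_one_zpow σ n
  simp only [termE, ratioE, thetaPochhammerNat_succ, Finset.prod_mul_distrib, zero_mul, zero_div,
    qPow_zero, hq, pow_succ]
  ring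

theorem termE_zero {r s : ℕ} (t : Fin r → ℂ) (w : Fin s → ℂ) (z : ℂ) :
    termE σ τ t w 0 z 0 = 1 := by
  simp [termE, thetaPochhammerNat]

theorem termG_zero {r s : ℕ} (t : Fin r → ℂ) (w : Fin s → ℂ) (z : ℂ) :
    termG σ τ t w 0 z 0 = 1 := by
  have h : ∀ t p q : ℂ, thetaPochhammer t p q 0 = 1 := fun t p q => by
    change thetaPochhammerNat t p q 0 = 1
    simp [thetaPochhammerNat]
  simp [termG, h]

theorem termG_add_one {r s : ℕ} (t : Fin r → ℂ) (w : Fin s → ℂ) {z : ℂ} (hz : z ≠ 0) {n : ℤ}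
    (hn : 0 ≤ n) :
    termG σ τ t w 0 z (n + 1) = ratioG σ τ t w 0 z n * termG σ τ t w 0 z n := by
  simp only [termG, ratioG, thetaPochhammer_add_one _ _ _ hn, Finset.prod_mul_distrib, zero_mul,
    zero_div, qPow_zero, qPow_one_zpow, zpow_add_one₀ hz]
  ring

/-- Only z has to be nonzero: if a theta factor vanishes, the convention 0⁻¹ = 0 makes both sides
agree, so a terminating series needs no separate case. -/
theorem termG_eq_inv_mul {r s : ℕ} (t : Fin r → ℂ) (w : Fin s → ℂ) {z : ℂ} (hz : z ≠ 0) {n : ℤ}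
    (hn : n < 0) :
    termG σ τ t w 0 z n = (ratioG σ τ t w 0 z n)⁻¹ * termG σ τ t w 0 z (n + 1) := by
  have key : ∀ A T B W y : ℂ,
      A * T⁻¹ / (B * W⁻¹) * 1 * y = (T / W * 1 * z)⁻¹ * (A / B * 1 * (y * z)) := by
    intros
    field_simp
  simp only [termG, ratioG, thetaPochhammer_eq_mul_inv (qPow_ne_zero σ 1) _ _ hn,
    Finset.prod_mul_distrib, zero_mul, zero_div, qPow_zero, qPow_one_zpow, zpow_add_one₀ hz,
    Finset.prod_inv_distrib]
  exact key _ _ _ _ _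

theorem ratioG_eq {n : ℕ} (u v : Fin n → ℂ) (z x : ℂ) :
    ratioG σ τ (fun m => qPow σ (u m)) (fun k => qPow σ (v k)) 0 z x =
      z * ((∏ m, addTheta σ τ (x + u m)) / ∏ k, addTheta σ τ (x + v k)) := by
  simp only [ratioG, theta_mul_qPow, zero_mul, qPow_zero]
  ring

/-- The factor θ(q^(x+1); p) is treated as a denominator parameter with exponent 1, so unilateral
ratios take the same form as bilateral ones. -/
theorem ratioE_eq {n : ℕ} (u : Fin (n + 1) → ℂ) (v : Fin n → ℂ) (z x : ℂ) :
    ratioE σ τ (fun m => qPow σ (u m)) (fun k => qPow σ (v k)) 0 z x =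
      z * ((∏ m, addTheta σ τ (x + u m)) /
        ∏ k, addTheta σ τ (x + (Fin.cons 1 v : Fin (n + 1) → ℂ) k)) := by
  simp only [ratioE, theta_mul_qPow, zero_mul, qPow_zero, Fin.prod_univ_succ, Fin.cons_zero,
    Fin.cons_succ]
  ring

theorem eventuallyEq_codiscrete_of_forall_nhdsNE {f g : ℂ → ℂ} (h : ∀ x, f =ᶠ[𝓝[≠] x] g) :
    f =ᶠ[codiscrete ℂ] g := by
  change {x | f x = g x} ∈ codiscreteWithin Set.univ
  rw [mem_codiscreteWithin_iff_forall_mem_nhdsNE]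
  intro x _
  rw [Set.compl_univ, Set.union_empty]
  exact h x

theorem IsUnilateralSeries.eq_termE (hσ : σ ≠ 0) (hτ : 0 < τ.im) {r : ℕ} {u : Fin (r + 1) → ℂ}
    {v : Fin r → ℂ} {z : ℂ} (hz : z ≠ 0)
    (hdisj : ∀ m k, u m - (Fin.cons 1 v : Fin (r + 1) → ℂ) k ∉ periodLattice σ τ) {h : ℂ → ℂ}
    (heq : ∀ x, h =ᶠ[𝓝[≠] x]
      ratioE σ τ (fun m => qPow σ (u m)) (fun k => qPow σ (v k)) 0 z)
    {c : ℕ → ℂ} (hc : IsUnilateralSeries h c) :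
    NonsingularE σ τ (fun k => qPow σ (v k)) ∧ ∀ n : ℕ, c n = c 0 *
      termE σ τ (fun m => qPow σ (u m)) (fun k => qPow σ (v k)) 0 z n := by
  simp only [funext (ratioE_eq u v z)] at heq
  constructor
  · intro n
    obtain ⟨a, ha, -⟩ := hc n
    have h1 := (eq_of_tendsto_theta_quotient hσ hτ hz hdisj (heq n) ha).1
    simp only [theta_mul_qPow]
    exact ⟨h1 0, fun k => h1 k.succ⟩
  · intro n
    induction n with
    | zero => rw [termE_zero, mul_one]
    | succ n ih =>
      obtain ⟨a, ha, hca⟩ := hc n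
      rw [hca, ih, termE_succ, ratioE_eq,
        (eq_of_tendsto_theta_quotient hσ hτ hz hdisj (heq n) ha).2]
      ring

theorem IsBilateralSeries.eq_termG (hσ : σ ≠ 0) (hτ : 0 < τ.im) {r : ℕ} {u v : Fin r → ℂ} {z : ℂ}
    (hz : z ≠ 0) (hdisj : ∀ m k, u m - v k ∉ periodLattice σ τ) {h : ℂ → ℂ}
    (heq : ∀ x, h =ᶠ[𝓝[≠] x]
      ratioG σ τ (fun m => qPow σ (u m)) (fun k => qPow σ (v k)) 0 z)
    {c : ℤ → ℂ} (hc : IsBilateralSeries h c) :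
    NonsingularG σ τ (fun m => qPow σ (u m)) (fun k => qPow σ (v k)) ∧ ∀ n : ℤ, c n = c 0 *
      termG σ τ (fun m => qPow σ (u m)) (fun k => qPow σ (v k)) 0 z n := by
  simp only [funext (ratioG_eq u v z)] at heq
  have hdisj' : ∀ m k, v m - u k ∉ periodLattice σ τ := fun m k hmem =>
    hdisj k m (by simpa using (periodLattice σ τ).neg_mem hmem)
  -- For negative indices 1 / h plays the role of h, with zeros and poles exchanged; hence the
  -- nonvanishing condition on t.
  have heq' : ∀ x, (fun y => (h y)⁻¹) =ᶠ[𝓝[≠] x] fun y =>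
      z⁻¹ * ((∏ k, addTheta σ τ (y + v k)) / ∏ m, addTheta σ τ (y + u m)) := fun x => by
    filter_upwards [heq x] with y hy
    rw [hy, mul_inv, inv_div]
  have hpos : ∀ n : ℤ, 0 ≤ n → (∀ k, addTheta σ τ (n + v k) ≠ 0) ∧ c (n + 1) =
      ratioG σ τ (fun m => qPow σ (u m)) (fun k => qPow σ (v k)) 0 z n * c n := fun n hn => by
    obtain ⟨a, ha, hca⟩ := hc.1 n hn
    obtain ⟨h1, h2⟩ := eq_of_tendsto_theta_quotient hσ hτ hz hdisj (heq n) ha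
    exact ⟨h1, by rw [hca, ratioG_eq, h2]⟩
  have hneg : ∀ n : ℤ, n < 0 → (∀ m, addTheta σ τ (n + u m) ≠ 0) ∧ c n =
      (ratioG σ τ (fun m => qPow σ (u m)) (fun k => qPow σ (v k)) 0 z n)⁻¹ * c (n + 1) :=
    fun n hn => by
    obtain ⟨a, ha, hca⟩ := hc.2 n hn
    obtain ⟨h1, h2⟩ := eq_of_tendsto_theta_quotient hσ hτ (inv_ne_zero hz) hdisj' (heq' n) ha
    exact ⟨h1, by rw [hca, ratioG_eq, h2, mul_inv, inv_div]⟩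
  refine ⟨⟨fun n hn k => ?_, fun n hn m => ?_⟩, fun n => ?_⟩
  · rw [theta_mul_qPow]
    exact (hpos n hn).1 k
  · rw [theta_mul_qPow]
    exact (hneg n hn).1 m
  · induction n with
    | zero => rw [termG_zero, mul_one]
    | succ i ih =>
      rw [(hpos i (Int.natCast_nonneg i)).2, ih, termG_add_one _ _ hz (Int.natCast_nonneg i)]
      ring
    | pred i ih =>
      have hn : -(i : ℤ) - 1 < 0 := by omega
      rw [(hneg _ hn).2, termG_eq_inv_mul _ _ hz hn, sub_add_cancel, ih]
      ring

/-- If a theta quotient has a pole at `P`, then, with the argument shifted by `P + 1`, it is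
the term ratio of a balanced unilateral series. -/
theorem exists_ratioE_of_pole (hσ : σ ≠ 0) (hτ : 0 < τ.im) {r : ℕ} {u v : Fin (r + 1) → ℂ} {z : ℂ}
    (hz : z ≠ 0) (hsum : ∑ m, u m = ∑ k, v k) (hdisj : ∀ m k, u m - v k ∉ periodLattice σ τ)
    {P : ℂ} {k₀ : Fin (r + 1)} (hk₀ : P + v k₀ ∈ periodLattice σ τ) :
    ∃ (u' : Fin (r + 1) → ℂ) (v' : Fin r → ℂ) (z' : ℂ), z' ≠ 0 ∧ BalancedE u' v' ∧
      (∀ m k, u' m - (Fin.cons 1 v' : Fin (r + 1) → ℂ) k ∉ periodLattice σ τ) ∧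
      ∀ x, z * ((∏ m, addTheta σ τ (P + 1 + x + u m)) / ∏ k, addTheta σ τ (P + 1 + x + v k)) =
        ratioE σ τ (fun m => qPow σ (u' m)) (fun k => qPow σ (v' k)) 0 z' x := by
  obtain ⟨l, j, hlj⟩ := mem_periodLattice.1 hk₀
  obtain ⟨c, hc, hshift⟩ := exists_addTheta_add_period hσ hτ l j
  rw [← hlj] at hshift
  set ω := P + v k₀ with hω
  -- The denominator factor of k₀ is θ at x + 1 + ω. Taking ω out of a numerator parameter as well
  -- makes the multipliers cancel up to the constant q^(-j(P + u 0 - ω)), and since ω = P + v k₀ it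
  -- leaves exactly the 1 in the balancing condition.
  set u₀ : Fin (r + 1) → ℂ := Fin.cons (P + 1 + u 0 - ω) fun m => P + 1 + u m.succ with hu₀
  have hu₀_mem : ∀ m, P + 1 + u m - u₀ m ∈ periodLattice σ τ := fun m => by
    refine Fin.cases ?_ (fun m => ?_) m
    · simpa [hu₀] using hk₀
    · simp [hu₀, (periodLattice σ τ).zero_mem]
  refine ⟨u₀, fun k => P + 1 + v (k₀.succAbove k), z * qPow σ (-(j * (P + u 0 - ω))),
    mul_ne_zero hz (qPow_ne_zero _ _), ?_, fun m k => ?_, fun x => ?_⟩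
  · rw [Fin.sum_univ_succ, Fin.sum_univ_succAbove v k₀] at hsum
    simp only [BalancedE, hu₀, Fin.sum_univ_succ, Fin.cons_zero, Fin.cons_succ,
      Finset.sum_add_distrib]
    linear_combination hsum - hω
  -- Apart from the common translation P + 1, parameters change only by periods, so no common zeros
  -- appear.
  · refine Fin.cases (fun hmem => ?_) (fun k hmem => ?_) k
    · refine hdisj m k₀ ?_
      have := (periodLattice σ τ).sub_mem ((periodLattice σ τ).add_mem (hu₀_mem m) hmem) hk₀
      simp only [Fin.cons_zero] at this
      convert this using 1
      rw [hω]
      ring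
    · refine hdisj m (k₀.succAbove k) ?_
      have := (periodLattice σ τ).add_mem (hu₀_mem m) hmem
      simp only [Fin.cons_succ] at this
      convert this using 1
      ring
  · rw [ratioE_eq, Fin.prod_univ_succ, Fin.prod_univ_succAbove _ k₀,
      Fin.prod_univ_succ (fun m => addTheta σ τ (x + u₀ m)),
      Fin.prod_univ_succ (fun k => addTheta σ τ (x + _))]
    simp only [hu₀, Fin.cons_zero, Fin.cons_succ]
    have h1 : ∀ y, P + 1 + x + y = x + (P + 1 + y) := fun y => by ring
    have h2 : x + (P + 1 + u 0) = (x + (P + 1 + u 0 - ω)) + ω := by ring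
    have h3 : x + (P + 1 + v k₀) = (x + 1) + ω := by rw [hω]; ring
    simp only [h1]
    rw [h2, h3, hshift, hshift, show -((j : ℂ) * (x + (P + 1 + u 0 - ω))) =
      -(j * (P + u 0 - ω)) + -(j * (x + 1)) by ring, qPow_add]
    have h4 := qPow_ne_zero σ (-((j : ℂ) * (x + 1)))
    field_simp

end EllipticHypergeometric

end

/-! ### Elliptic term ratios give balanced theta hypergeometric series -/

theorem theorem2 (σ τ : ℂ) (hσ : σ ≠ 0) (hτ : 0 < τ.im) (r : ℕ) (h : ℂ → ℂ)
    (hell : EllipticHypergeometric.IsElliptic σ τ h)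
    (hord : EllipticHypergeometric.ellipticOrder σ τ h = r + 1) :
    (∀ P : ℂ, meromorphicOrderAt h P < 0 →
      ∃ (u : Fin (r + 1) → ℂ) (v : Fin r → ℂ) (z : ℂ),
        z ≠ 0 ∧ EllipticHypergeometric.BalancedE u v ∧
        (fun x : ℂ => h (P + 1 + x)) =ᶠ[codiscrete ℂ]
          EllipticHypergeometric.ratioE σ τ
            (fun m => EllipticHypergeometric.qPow σ (u m))
            (fun k => EllipticHypergeometric.qPow σ (v k)) 0 z ∧
        ∀ c : ℕ → ℂ,
          EllipticHypergeometric.IsUnilateralSeries (fun x : ℂ => h (P + 1 + x)) c →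
          EllipticHypergeometric.NonsingularE σ τ
            (fun k => EllipticHypergeometric.qPow σ (v k)) ∧
          ∀ n : ℕ, c n = c 0 * EllipticHypergeometric.termE σ τ
            (fun m => EllipticHypergeometric.qPow σ (u m))
            (fun k => EllipticHypergeometric.qPow σ (v k)) 0 z n) ∧
    (∃ (u v : Fin (r + 1) → ℂ) (z : ℂ),
        z ≠ 0 ∧ EllipticHypergeometric.BalancedG u v ∧
        h =ᶠ[codiscrete ℂ]
          EllipticHypergeometric.ratioG σ τ
            (fun m => EllipticHypergeometric.qPow σ (u m))
            (fun k => EllipticHypergeometric.qPow σ (v k)) 0 z ∧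
        ∀ c : ℤ → ℂ,
          EllipticHypergeometric.IsBilateralSeries h c →
          EllipticHypergeometric.NonsingularG σ τ
            (fun m => EllipticHypergeometric.qPow σ (u m))
            (fun k => EllipticHypergeometric.qPow σ (v k)) ∧
          ∀ n : ℤ, c n = c 0 * EllipticHypergeometric.termG σ τ
            (fun m => EllipticHypergeometric.qPow σ (u m))
            (fun k => EllipticHypergeometric.qPow σ (v k)) 0 z n) := by
  -- A single theta quotient serves both parts: directly in the bilateral case, translated by P + 1
  -- in the unilateral one.
  obtain ⟨u, v, z, hz, hsum, hdisj, heq⟩ := hell.exists_eq_theta_quotient hσ hτ hord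
  refine ⟨fun P hP => ?_, u, v, z, hz, hsum, ?_, fun c hc => ?_⟩
  · obtain ⟨k₀, hk₀⟩ :=
      EllipticHypergeometric.exists_add_mem_periodLattice_of_pole hσ hτ (heq P) hP
    obtain ⟨u', v', z', hz', hbal, hdisj', hratio⟩ :=
      EllipticHypergeometric.exists_ratioE_of_pole hσ hτ hz hsum hdisj hk₀
    have heq' : ∀ x, (fun x : ℂ => h (P + 1 + x)) =ᶠ[𝓝[≠] x]
        EllipticHypergeometric.ratioE σ τ (fun m => EllipticHypergeometric.qPow σ (u' m))
          (fun k => EllipticHypergeometric.qPow σ (v' k)) 0 z' := fun x => by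
      filter_upwards [EllipticHypergeometric.eventually_nhdsNE_add (P + 1) (heq (x + (P + 1)))]
        with y hy
      rw [← hratio, add_comm (P + 1) y, hy]
    exact ⟨u', v', z', hz', hbal,
      EllipticHypergeometric.eventuallyEq_codiscrete_of_forall_nhdsNE heq',
      fun c hc => hc.eq_termE hσ hτ hz' hdisj' heq'⟩
  · refine EllipticHypergeometric.eventuallyEq_codiscrete_of_forall_nhdsNE fun x => ?_
    simpa only [funext (EllipticHypergeometric.ratioG_eq u v z)] using heq x
  · refine hc.eq_termG hσ hτ hz hdisj fun x => ?_
    simpa only [funext (EllipticHypergeometric.ratioG_eq u v z)] using heq x
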